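/- Let $X=\{X(n):n\ge 0\}$ be a Markov chain on a state space $(\mathsf X,\mathcal B)$ with countably generated $\sigma$-algebra $\mathcal B$, with transition kernel $P$ and $n$-step kernels $P^n$. Suppose: (i) the chain is reversible with respect to a probability measure $\pi$, that is, $\pi(dx)P(x,dy)=\pi(dy)P(y,dx)$; (ii) the chain is $\psi$-irreducible and aperiodic, that is, $\psi$ is a nonzero $\sigma$-finite measure such that, for every $A\in\mathcal B$ with $\psi(A)>0$ and every $x\in\mathsf X$, $P^n(x,A)>0$ for all sufficiently large $n$, and $\psi$ is maximal in the sense that every other $\sigma$-finite measure with this property is absolutely continuous with respect to $\psi$. View $P$, $PF(x)=\int F(y)\,P(x,dy)$, as a bounded linear operator on the complex Hilbert space $L_2=L_2(\pi)$, and let $\mathcal S_2$ be the set of nonzero $\lambda\in\mathbb C$ for which $\lambda I-P$ has no bounded inverse on $L_2$. Suppose that $P$ admits a spectral gap in $L_2$: there is $\varepsilon_0>0$ such that $\mathcal S_2\cap\{z:|z|\ge 1-\varepsilon_0\}$ is finite and contains only poles of finite multiplicity (isolated points of the spectrum whose spectral projection $\frac{1}{2\pi i}\oint (zI-P)^{-1}dz$,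 taken over a small circle around the point, has finite rank). Suppose also that $$\delta_2:=1-\sup\{|\lambda| : \lambda\in\mathcal S_2,\ \lambda\ne 1\}>0,\qquad \sup\emptyset:=0.$$ For a signed measure $\nu$ on $(\mathsf X,\mathcal B)$ let $\|\nu\|_{\rm TV}:=\sup_{A\in\mathcal B}|\nu(A)|$, and let $\|\nu\|_2$ be the $L_2(\pi)$-norm of the density $d\nu/d\pi$ if the density exists, and $\|\nu\|_2:=\infty$ otherwise. Then for every initial distribution (probability measure) $\mu$ and every $n\ge 1$, $$\|\mu P^n-\pi\|_{\rm TV}\le \tfrac12\,\|\mu-\pi\|_2\,(1-\delta_2)^n ,$$ where nothing is claimed if the right-hand side is the indeterminate product $\infty\cdot 0$ (that is, if $\|\mu-\pi\|_2=\infty$ and $\delta_2=1$). -/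

import Mathlib

open MeasureTheory ProbabilityTheory Filter
open scoped ENNReal

namespace MarkovL2

noncomputable section

/-- The `n`-step kernel of a Markov chain is a Markov kernel. -/
instance isMarkovKernel_pow {X : Type*} [MeasurableSpace X] (P : Kernel X X) [IsMarkovKernel P]
    (n : ℕ) : IsMarkovKernel (P ^ n) := by
  induction n with
  | zero => rw [pow_zero]; exact inferInstanceAs (IsMarkovKernel Kernel.id)
  | succ n ih => rw [pow_succ]; exact inferInstanceAs (IsMarkovKernel ((P ^ n) ∘ₖ P))

/-! ### Irreducibility and aperiodicity -/

/-- Every set charged by `ψ` is charged by `P ^ n` for all large `n`, from every initial state. -/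
def EventuallyCharges {X : Type*} [MeasurableSpace X] (P : Kernel X X) (ψ : Measure X) : Prop :=
  ∀ A : Set X, MeasurableSet A → 0 < ψ A → ∀ x : X, ∀ᶠ n : ℕ in atTop, 0 < (P ^ n) x A

/-- The chain with transition kernel `P` is `ψ`-irreducible and aperiodic, with `ψ` a (nonzero,
σ-finite) maximal irreducibility measure. -/
structure IsPsiIrreducibleAperiodic {X : Type*} [MeasurableSpace X] (P : Kernel X X)
    (ψ : Measure X) : Prop where
  sigmaFinite : SigmaFinite ψ
  ne_zero : ψ ≠ 0
  charges : EventuallyCharges P ψ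
  maximal : ∀ ψ' : Measure X, SigmaFinite ψ' → EventuallyCharges P ψ' → ψ' ≪ ψ

/-! ### The transition kernel as an operator on complex `L²(π)` -/

section Operator

variable {X : Type*} [MeasurableSpace X] {P : Kernel X X} [IsMarkovKernel P] {π : Measure X}
  [IsProbabilityMeasure π]

lemma ae_ae_of_ae (h : P.Invariant π) {p : X → Prop} (hp : ∀ᵐ x ∂π, p x) :
    ∀ᵐ x ∂π, ∀ᵐ y ∂(P x), p y := by
  have hp' : ∀ᵐ x ∂(π.bind P), p x := by rwa [h.def]
  exact Measure.ae_ae_of_ae_bind P.measurable.aemeasurable hp'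

lemma integral_ae_congr (h : P.Invariant π) {f g : X → ℂ} (hfg : f =ᵐ[π] g) :
    (fun x => ∫ y, f y ∂(P x)) =ᵐ[π] fun x => ∫ y, g y ∂(P x) := by
  filter_upwards [ae_ae_of_ae h hfg] with x hx using integral_congr_ae hx

lemma lintegral_lintegral_enorm_sq (h : P.Invariant π) {f : X → ℂ} (hf : StronglyMeasurable f) :
    ∫⁻ x, ∫⁻ y, ‖f y‖ₑ ^ (2 : ℝ) ∂(P x) ∂π = ∫⁻ x, ‖f x‖ₑ ^ (2 : ℝ) ∂π := by
  rw [← Measure.lintegral_bind P.measurable.aemeasurable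
    (by have := hf.measurable; fun_prop), h.def]

lemma enorm_integral_sq_le {f : X → ℂ} (hf : StronglyMeasurable f) (x : X) :
    ‖∫ y, f y ∂(P x)‖ₑ ^ (2 : ℝ) ≤ ∫⁻ y, ‖f y‖ₑ ^ (2 : ℝ) ∂(P x) := by
  have h1 : ‖∫ y, f y ∂(P x)‖ₑ ≤ eLpNorm f 2 (P x) :=
    (enorm_integral_le_lintegral_enorm f).trans <| by
      rw [← eLpNorm_one_eq_lintegral_enorm]
      exact eLpNorm_le_eLpNorm_of_exponent_le (by norm_num) hf.aestronglyMeasurable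
  refine (ENNReal.rpow_le_rpow h1 (by norm_num)).trans (le_of_eq ?_)
  rw [eLpNorm_eq_lintegral_rpow_enorm_toReal (by norm_num) (by norm_num), ENNReal.toReal_ofNat,
    ← ENNReal.rpow_mul]
  norm_num

lemma eLpNorm_integral_le_aux (h : P.Invariant π) {f : X → ℂ} (hf : StronglyMeasurable f) :
    eLpNorm (fun x => ∫ y, f y ∂(P x)) 2 π ≤ eLpNorm f 2 π := by
  rw [eLpNorm_eq_lintegral_rpow_enorm_toReal (by norm_num) (by norm_num),
    eLpNorm_eq_lintegral_rpow_enorm_toReal (by norm_num) (by norm_num), ENNReal.toReal_ofNat,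
    ← lintegral_lintegral_enorm_sq h hf]
  exact ENNReal.rpow_le_rpow (lintegral_mono fun x => enorm_integral_sq_le hf x) (by norm_num)

lemma eLpNorm_integral_le (h : P.Invariant π) {f : X → ℂ} (hf : AEStronglyMeasurable f π) :
    eLpNorm (fun x => ∫ y, f y ∂(P x)) 2 π ≤ eLpNorm f 2 π := by
  rw [eLpNorm_congr_ae (integral_ae_congr h hf.ae_eq_mk), eLpNorm_congr_ae hf.ae_eq_mk]
  exact eLpNorm_integral_le_aux h hf.stronglyMeasurable_mk

lemma memLp_integral (h : P.Invariant π) {f : X → ℂ} (hf : MemLp f 2 π) :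
    MemLp (fun x => ∫ y, f y ∂(P x)) 2 π := by
  refine ⟨?_, (eLpNorm_integral_le h hf.1).trans_lt hf.2⟩
  exact ⟨_, hf.1.stronglyMeasurable_mk.integral_kernel, integral_ae_congr h hf.1.ae_eq_mk⟩

lemma ae_integrable (h : P.Invariant π) {f : X → ℂ} (hf : MemLp f 2 π) :
    ∀ᵐ x ∂π, Integrable f (P x) := by
  have hi : Integrable f (P ∘ₘ π) := by
    rw [h.def]; exact hf.integrable (by norm_num)
  exact ((Measure.integrable_comp_iff hi.1).1 hi).1

/-- The operator `(P f)(x) = ∫ f(y) P(x, dy)` on `L²(π)`, for `π` invariant under `P`. -/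
def l2Operator (P : Kernel X X) [IsMarkovKernel P] (π : Measure X) [IsProbabilityMeasure π]
    (h : P.Invariant π) : Lp ℂ 2 π →L[ℂ] Lp ℂ 2 π :=
  LinearMap.mkContinuous
    { toFun := fun f => (memLp_integral h (Lp.memLp f)).toLp (fun x => ∫ y, f y ∂(P x))
      map_add' := by
        intro f g
        rw [← MemLp.toLp_add, MemLp.toLp_eq_toLp_iff]
        filter_upwards [integral_ae_congr h (Lp.coeFn_add f g), ae_integrable h (Lp.memLp f),
          ae_integrable h (Lp.memLp g)] with x hx hf hg
        rw [hx]
        exact integral_add hf hg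
      map_smul' := by
        intro c f
        rw [RingHom.id_apply, ← MemLp.toLp_const_smul, MemLp.toLp_eq_toLp_iff]
        filter_upwards [integral_ae_congr h (Lp.coeFn_smul c f)] with x hx
        rw [hx]
        exact integral_smul c _ }
    1
    (by
      intro f
      rw [one_mul, LinearMap.coe_mk, AddHom.coe_mk, Lp.norm_toLp, Lp.norm_def]
      exact ENNReal.toReal_mono (Lp.memLp f).2.ne (eLpNorm_integral_le h (Lp.memLp f).1))

lemma l2Operator_apply (h : P.Invariant π) (f : Lp ℂ 2 π) :
    l2Operator P π h f =ᵐ[π] fun x => ∫ y, f y ∂(P x) :=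
  MemLp.coeFn_toLp (memLp_integral h (Lp.memLp f))

end Operator

/-! ### Spectrum and spectral gap -/

/-- The nonzero complex numbers `z` for which `z I - T` has no bounded inverse. -/
def nonzeroSpectrum {E : Type*} [NormedAddCommGroup E] [NormedSpace ℂ E] (T : E →L[ℂ] E) :
    Set ℂ :=
  {z : ℂ | z ≠ 0 ∧ z ∈ spectrum ℂ T}

/-- The spectral projection `(2πi)⁻¹ ∮ (z I - T)⁻¹ dz`, the contour being the circle with centre
`w` and radius `r`. -/
def rieszProjection {E : Type*} [NormedAddCommGroup E] [NormedSpace ℂ E] (T : E →L[ℂ] E)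
    (w : ℂ) (r : ℝ) : E →L[ℂ] E :=
  (2 * (Real.pi : ℂ) * Complex.I)⁻¹ • ∮ z in C(w, r), resolvent T z

/-- `w` is a pole of finite multiplicity: it is an isolated point of the spectrum whose spectral
projection has finite rank. -/
def IsPoleOfFiniteMultiplicity {E : Type*} [NormedAddCommGroup E] [NormedSpace ℂ E]
    (T : E →L[ℂ] E) (w : ℂ) : Prop :=
  ∃ r : ℝ, 0 < r ∧ spectrum ℂ T ∩ Metric.closedBall w r = {w} ∧
    FiniteDimensional ℂ (rieszProjection T w r).range

/-- `T` admits a spectral gap: near and outside the unit circle, the spectrum consists of finitely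
many poles of finite multiplicity. -/
def HasSpectralGap {E : Type*} [NormedAddCommGroup E] [NormedSpace ℂ E] (T : E →L[ℂ] E) : Prop :=
  ∃ ε : ℝ, 0 < ε ∧ (nonzeroSpectrum T ∩ {z : ℂ | 1 - ε ≤ ‖z‖}).Finite ∧
    ∀ z ∈ nonzeroSpectrum T, 1 - ε ≤ ‖z‖ → IsPoleOfFiniteMultiplicity T z

/-- The size `1 - sup {|z| : z ∈ S, z ≠ 1}` of the spectral gap, `S` being the nonzero spectrum
(the supremum of the empty set is `0`). -/
def spectralGap {E : Type*} [NormedAddCommGroup E] [NormedSpace ℂ E] (T : E →L[ℂ] E) : ℝ :=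
  1 - sSup {s : ℝ | ∃ z ∈ nonzeroSpectrum T, z ≠ 1 ∧ s = ‖z‖}

/-! ### Norms of signed measures -/

/-- The total variation norm `sup_A |ν(A)|`. -/
def tvNorm {X : Type*} [MeasurableSpace X] (ν : SignedMeasure X) : ℝ≥0∞ :=
  ⨆ A : {A : Set X // MeasurableSet A}, ‖ν A.1‖ₑ

open Classical in
/-- The `L²(π)`-norm of the density `dν/dπ` if it exists, and `∞` otherwise. -/
def l2Norm {X : Type*} [MeasurableSpace X] (π : Measure X) (ν : SignedMeasure X) : ℝ≥0∞ :=
  if VectorMeasure.AbsolutelyContinuous ν π.toENNRealVectorMeasure then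
    eLpNorm (ν.rnDeriv π) 2 π
  else ∞

end

end MarkovL2

/-! Let `T` be the operator of the chain, `Q` the projection onto constants and `g` the density of
`μ - π`. By duality `(μPⁿ - π)(A)` is the pairing of `g` with `Tⁿ 1_A`. Since `g` has mean zero and
`Tⁿ - Q` kills constants, this equals `⟨g, (Tⁿ - Q)(1_A - 1/2)⟩`, and Cauchy–Schwarz bounds it by
`‖g‖ · ‖Tⁿ - Q‖ · 1/2`.

It remains to see that `‖Tⁿ - Q‖ ≤ (1 - δ₂)ⁿ`. For `n ≥ 1`, `Tⁿ - Q = (T - Q)ⁿ`, and by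
reversibility `T - Q` is self-adjoint, so its norm is its spectral radius. Away from 0 and 1 its
spectrum lies in that of `T` (`mem_spectrum_of_mem_spectrum_sub`). If 1 belonged to it, 1 would be
isolated, hence an eigenvalue (`one_notMem_spectrum_of_isolated`), giving a nonzero `T`-fixed vector
orthogonal to constants; irreducibility forbids this (`exists_eq_smul_l2One`). -/

namespace MarkovL2

/-! ### Spectrum after removal of an idempotent -/

section Hilbert

variable {H : Type*} [NormedAddCommGroup H] [NormedSpace ℂ H]

lemma norm_le_one_sub_spectralGap [CompleteSpace H] (T : H →L[ℂ] H) {z : ℂ}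
    (hz : z ∈ spectrum ℂ T) (h1 : z ≠ 1) : ‖z‖ ≤ 1 - spectralGap T := by
  rw [spectralGap, sub_sub_cancel]
  rcases eq_or_ne z 0 with rfl | h0
  · rw [norm_zero]
    refine Real.sSup_nonneg ?_
    rintro s ⟨w, -, -, rfl⟩
    exact norm_nonneg w
  · refine le_csSup ⟨‖T‖ * ‖(1 : H →L[ℂ] H)‖, ?_⟩ ⟨z, ⟨h0, hz⟩, h1, rfl⟩
    rintro s ⟨w, hw, -, rfl⟩
    exact spectrum.norm_le_norm_mul_of_mem hw.2

lemma one_sub_spectralGap_nonneg (T : H →L[ℂ] H) : 0 ≤ 1 - spectralGap T := by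
  rw [spectralGap, sub_sub_cancel]
  refine Real.sSup_nonneg ?_
  rintro s ⟨w, -, -, rfl⟩
  exact norm_nonneg w

/-- Removing an idempotent `Q` with `T * Q = Q = Q * T` from `T` adds no spectrum outside
`{0, 1}`. -/
lemma mem_spectrum_of_mem_spectrum_sub {A : Type*} [Ring A] [Algebra ℂ A] {T Q : A}
    (hQ : Q * Q = Q) (hTQ : T * Q = Q) (hQT : Q * T = Q) {z : ℂ} (h0 : z ≠ 0) (h1 : z ≠ 1)
    (hz : z ∈ spectrum ℂ (T - Q)) : z ∈ spectrum ℂ T := by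
  by_contra hT
  rw [spectrum.notMem_iff] at hT
  refine hz ?_
  rw [spectrum.mem_resolventSet_iff]
  set a := algebraMap ℂ A z with ha
  obtain ⟨u, hu⟩ := hT
  have haQ : a * Q = z • Q := (Algebra.smul_def z Q).symm
  have hQa : Q * a = z • Q := by rw [ha, ← Algebra.commutes, ← Algebra.smul_def]
  have hQu : Q * (u : A) = (z - 1) • Q := by
    rw [hu, mul_sub, hQT, hQa, sub_smul, one_smul]
  have huQ : (u : A) * Q = (z - 1) • Q := by
    rw [hu, sub_mul, hTQ, haQ, sub_smul, one_smul]
  have hz1 : z - 1 ≠ 0 := sub_ne_zero.2 h1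
  have hQi : Q * (↑u⁻¹ : A) = (z - 1)⁻¹ • Q := by
    rw [Units.mul_inv_eq_iff_eq_mul, smul_mul_assoc, hQu, inv_smul_smul₀ hz1]
  have hiQ : (↑u⁻¹ : A) * Q = (z - 1)⁻¹ • Q := by
    rw [Units.inv_mul_eq_iff_eq_mul, mul_smul_comm, huQ, inv_smul_smul₀ hz1]
  have hS : a - (T - Q) = u + Q := by rw [hu]; abel
  have c : (z - 1) * (z⁻¹ - (z - 1)⁻¹) + (z - 1)⁻¹ + (z⁻¹ - (z - 1)⁻¹) = 0 := by
    field_simp; ring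
  rw [hS]
  -- On the range of `Q`, `u = z - T` acts as `z - 1` and `u + Q` as `z`; the inverse of `u` is
  -- corrected there accordingly.
  refine ⟨⟨u + Q, ↑u⁻¹ + (z⁻¹ - (z - 1)⁻¹) • Q, ?_, ?_⟩, rfl⟩
  · rw [add_mul, mul_add, mul_add, Units.mul_inv, hQi, mul_smul_comm, mul_smul_comm, huQ, hQ,
      smul_smul, add_assoc, ← add_smul, ← add_smul]
    rw [show (z⁻¹ - (z - 1)⁻¹) * (z - 1) + ((z - 1)⁻¹ + (z⁻¹ - (z - 1)⁻¹)) = 0 by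
      rw [← c]; ring, zero_smul, add_zero]
  · rw [add_mul, mul_add, mul_add, Units.inv_mul, hiQ, smul_mul_assoc, smul_mul_assoc, hQu, hQ,
      smul_smul, add_assoc, ← add_smul, ← add_smul]
    rw [show (z - 1)⁻¹ + ((z⁻¹ - (z - 1)⁻¹) * (z - 1) + (z⁻¹ - (z - 1)⁻¹)) = 0 by
      rw [← c]; ring, zero_smul, add_zero]

end Hilbert

/-! ### Norm bounds from the spectrum of a self-adjoint operator -/

section SelfAdjoint

variable {H : Type*} [NormedAddCommGroup H] [InnerProductSpace ℂ H] [CompleteSpace H]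

/-- An isolated point at `1` of the spectrum of a self-adjoint operator is an eigenvalue. -/
lemma one_notMem_spectrum_of_isolated {S : H →L[ℂ] H} (hS : IsSelfAdjoint S) {ρ : ℝ} (hρ : ρ < 1)
    (hσ : ∀ z ∈ spectrum ℂ S, z ≠ 1 → ‖z‖ ≤ ρ) (hfix : ∀ h, S h = h → h = 0) :
    (1 : ℂ) ∉ spectrum ℂ S := by
  intro h1
  have hn : IsStarNormal S := hS.isStarNormal
  -- `φ` is continuous, vanishes on the spectrum off 1, and is nonzero at 1. So `z φ(z) = φ(z)` on
  -- the spectrum: the range of `φ(S)` consists of fixed vectors, which forces `φ(S) = 0`, against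
  -- spectral mapping.
  let φ : ℂ → ℂ := fun z => ((max 0 (‖z‖ - ρ) : ℝ) : ℂ)
  have hφ : Continuous φ := by fun_prop
  have hmul : S * cfc φ S = cfc φ S := by
    conv_lhs => enter [1]; rw [← cfc_id' ℂ S]
    rw [← cfc_mul (fun z : ℂ => z) φ S]
    · refine cfc_congr fun z hz => ?_
      by_cases hz1 : z = 1
      · simp [hz1]
      · have : φ z = 0 := by
          simp only [φ]
          rw [max_eq_left (by linarith [hσ z hz hz1]), Complex.ofReal_zero]
        simp [this]
  have h0 : cfc φ S = 0 := by
    ext h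
    exact hfix _ (by simpa using congr($hmul h))
  have hmem : φ 1 ∈ spectrum ℂ (cfc φ S) := by
    rw [cfc_map_spectrum φ S]
    exact ⟨1, h1, rfl⟩
  rw [h0] at hmem
  have hφ1 : φ 1 = ((1 - ρ : ℝ) : ℂ) := by
    simp only [φ]
    rw [norm_one, max_eq_right (by linarith)]
  refine hmem ?_
  rw [spectrum.mem_resolventSet_iff, sub_zero, hφ1]
  refine (IsUnit.mk0 _ ?_).map _
  exact_mod_cast (sub_pos.2 hρ).ne'

lemma norm_sub_le_one_sub_spectralGap {T Q : H →L[ℂ] H} (hT : IsSelfAdjoint T)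
    (hQ : IsStarProjection Q) (hTQ : T * Q = Q) (hfix : ∀ h, T h = h → Q h = h)
    (hgap : 0 < spectralGap T) : ‖T - Q‖ ≤ 1 - spectralGap T := by
  have hQQ : Q * Q = Q := hQ.isIdempotentElem
  have hQT : Q * T = Q := by
    have := congr(star $hTQ)
    rwa [star_mul, hT.star_eq, hQ.isSelfAdjoint.star_eq] at this
  have hS : IsSelfAdjoint (T - Q) := hT.sub hQ.isSelfAdjoint
  have hQS : Q * (T - Q) = 0 := by rw [mul_sub, hQT, hQQ, sub_self]
  have hσ : ∀ z ∈ spectrum ℂ (T - Q), z ≠ 1 → ‖z‖ ≤ 1 - spectralGap T := by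
    intro z hz h1
    rcases eq_or_ne z 0 with rfl | h0
    · rw [norm_zero]; exact one_sub_spectralGap_nonneg T
    · exact norm_le_one_sub_spectralGap T (mem_spectrum_of_mem_spectrum_sub hQQ hTQ hQT h0 h1 hz) h1
  have h1 : (1 : ℂ) ∉ spectrum ℂ (T - Q) := by
    refine one_notMem_spectrum_of_isolated hS (sub_lt_self 1 hgap) hσ fun h hh => ?_
    have hQh : Q h = 0 := by
      have : Q ((T - Q) h) = 0 := by simpa using congr($hQS h)
      rwa [hh] at this
    have hTh : T h = h := by simpa [hQh] using hh
    rw [← hfix h hTh, hQh]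
  have hle : spectralRadius ℂ (T - Q) ≤ ENNReal.ofReal (1 - spectralGap T) := by
    refine iSup₂_le fun z hz => ?_
    rw [← enorm_eq_nnnorm, ← ofReal_norm]
    exact ENNReal.ofReal_le_ofReal (hσ z hz fun h => h1 (h ▸ hz))
  rw [hS.spectralRadius_eq_nnnorm, ← enorm_eq_nnnorm, ← ofReal_norm] at hle
  exact (ENNReal.ofReal_le_ofReal_iff (one_sub_spectralGap_nonneg T)).1 hle

/-- Fails at `n = 0`, where the left side is `1` and the right side `1 - Q`. -/
lemma sub_pow_eq_pow_sub {A : Type*} [Ring A] {T Q : A} (hQ : Q * Q = Q) (hTQ : T * Q = Q)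
    (hQT : Q * T = Q) {n : ℕ} (hn : 1 ≤ n) : (T - Q) ^ n = T ^ n - Q := by
  induction n, hn using Nat.le_induction with
  | base => simp
  | succ n hn ih =>
    have hQn : Q * T ^ n = Q := by
      clear ih hn
      induction n with
      | zero => simp
      | succ n ih => rw [pow_succ, ← mul_assoc, ih, hQT]
    rw [pow_succ', ih, sub_mul, mul_sub, mul_sub, hQn, hQ, hTQ, pow_succ']
    abel

end SelfAdjoint

/-! ### Invariant kernels and harmonic functions -/

section Kernel

variable {X : Type*} [MeasurableSpace X]

lemma invariant_pow {P : Kernel X X} {π : Measure X} (h : P.Invariant π) (n : ℕ) :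
    (P ^ n).Invariant π := by
  induction n with
  | zero => rw [pow_zero]; exact Measure.id_comp
  | succ n ih => rw [pow_succ]; exact ih.comp h

lemma integral_comp_measure {Y E : Type*} [MeasurableSpace Y] [NormedAddCommGroup E]
    [NormedSpace ℝ E] {κ : Kernel X Y} {π : Measure X} {f : Y → E}
    (hf : Integrable f (κ ∘ₘ π)) : ∫ y, f y ∂(κ ∘ₘ π) = ∫ x, ∫ y, f y ∂(κ x) ∂π := by
  rw [Measure.comp_eq_comp_const_apply] at hf ⊢
  rw [Kernel.integral_comp hf, Kernel.const_apply]

lemma measureReal_bind {μ : Measure X} {K : Kernel X X} [IsMarkovKernel K] {A : Set X}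
    (hA : MeasurableSet A) :
    (μ.bind K).real A = ∫ x, (K x).real A ∂μ := by
  simp_rw [measureReal_def]
  rw [Measure.bind_apply hA K.aemeasurable,
    integral_toReal (K.measurable_coe hA).aemeasurable (ae_of_all _ fun x => measure_lt_top _ _)]

lemma ae_memLp {K : Kernel X X} {π : Measure X} (h : K.Invariant π) {f : X → ℂ}
    (hf : MemLp f 2 π) (hm : StronglyMeasurable f) : ∀ᵐ x ∂π, MemLp f 2 (K x) := by
  have hi : Integrable (fun x => ‖f x‖ ^ 2) (K ∘ₘ π) := by
    rw [h.def]; exact (memLp_two_iff_integrable_sq_norm hf.1).1 hf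
  filter_upwards [((Measure.integrable_comp_iff hi.1).1 hi).1] with x hx
  exact (memLp_two_iff_integrable_sq_norm hm.aestronglyMeasurable).2 hx

lemma integral_norm_sub_sq {ν : Measure X} [IsProbabilityMeasure ν] {f : X → ℂ}
    (hf : MemLp f 2 ν) {c : ℂ} (hc : ∫ y, f y ∂ν = c) :
    ∫ y, ‖f y - c‖ ^ 2 ∂ν = ∫ y, ‖f y‖ ^ 2 ∂ν - ‖c‖ ^ 2 := by
  have hi : Integrable f ν := hf.integrable (by norm_num)
  have hi2 : Integrable (fun x => ‖f x‖ ^ 2) ν := (memLp_two_iff_integrable_sq_norm hf.1).1 hf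
  have hi3 : Integrable (fun x => inner ℝ c (f x)) ν := hi.const_inner c
  simp_rw [norm_sub_sq_real, real_inner_comm]
  rw [integral_add (f := fun y => ‖f y‖ ^ 2 - 2 * inner ℝ c (f y)) (hi2.sub (hi3.const_mul 2))
      (integrable_const _),
    integral_sub hi2 (hi3.const_mul 2), integral_const_mul, integral_inner hi, hc,
    real_inner_self_eq_norm_sq]
  simp
  ring

/-- A square-integrable function that is harmonic for a kernel preserving `π` is almost surely
preserved by the transitions of the kernel. -/
lemma ae_ae_eq_of_integral_eq {K : Kernel X X} [IsMarkovKernel K] {π : Measure X}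
    (h : K.Invariant π) {f : X → ℂ} (hf : MemLp f 2 π)
    (hm : StronglyMeasurable f) (hK : (fun x => ∫ y, f y ∂(K x)) =ᵐ[π] f) :
    ∀ᵐ x ∂π, ∀ᵐ y ∂(K x), f y = f x := by
  have hi : Integrable (fun x => ‖f x‖ ^ 2) π := (memLp_two_iff_integrable_sq_norm hf.1).1 hf
  have hi' : Integrable (fun x => ‖f x‖ ^ 2) (K ∘ₘ π) := by rwa [h.def]
  have hi'' : Integrable (fun x => ∫ y, ‖f y‖ ^ 2 ∂(K x)) π := by
    simpa using ((Measure.integrable_comp_iff hi'.1).1 hi').2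
  have hmem := ae_memLp h hf hm
  have hvar : ∀ᵐ x ∂π, ∫ y, ‖f y - f x‖ ^ 2 ∂(K x) = ∫ y, ‖f y‖ ^ 2 ∂(K x) - ‖f x‖ ^ 2 := by
    filter_upwards [hmem, hK] with x hx hKx using integral_norm_sub_sq hx hKx
  -- By harmonicity the integrand is the conditional variance of `f`; by invariance its mean is
  -- zero, so it vanishes almost everywhere.
  have hint : ∫ x, (∫ y, ‖f y‖ ^ 2 ∂(K x) - ‖f x‖ ^ 2) ∂π = 0 := by
    rw [integral_sub hi'' hi, ← integral_comp_measure hi', h.def, sub_self]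
  have hnn : 0 ≤ᵐ[π] fun x => ∫ y, ‖f y‖ ^ 2 ∂(K x) - ‖f x‖ ^ 2 := by
    filter_upwards [hvar] with x hx
    rw [Pi.zero_apply, ← hx]
    positivity
  filter_upwards [hvar, (integral_eq_zero_iff_of_nonneg_ae hnn (hi''.sub hi)).1 hint, hmem]
    with x hx h0 hx2
  rw [h0, Pi.zero_apply, integral_eq_zero_iff_of_nonneg (fun y => by positivity)] at hx
  · filter_upwards [hx] with y hy
    exact sub_eq_zero.1 (norm_eq_zero.1 (pow_eq_zero_iff two_ne_zero |>.1 hy))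
  · exact (memLp_two_iff_integrable_sq_norm
      (hm.sub stronglyMeasurable_const).aestronglyMeasurable).1 (hx2.sub (memLp_const (f x)))

/-! ### The transition operator on `L²(π)` -/

variable {K : Kernel X X} [IsMarkovKernel K] {π : Measure X} [IsProbabilityMeasure π]

lemma l2Operator_pow_apply (h : K.Invariant π) (f : Lp ℂ 2 π) (n : ℕ) :
    (l2Operator K π h ^ n) f =ᵐ[π] fun x => ∫ y, f y ∂((K ^ n) x) := by
  induction n with
  | zero =>
    refine ae_of_all _ fun x => ?_
    rw [pow_zero, pow_zero]
    exact (integral_dirac' _ x (Lp.stronglyMeasurable f)).symm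
  | succ n ih =>
    rw [pow_succ']
    filter_upwards [l2Operator_apply h ((l2Operator K π h ^ n) f), integral_ae_congr h ih,
      ae_integrable (invariant_pow h (n + 1)) (Lp.memLp f)] with x hx hx' hi
    rw [mul_apply_eq_comp, hx, hx']
    rw [pow_succ] at hi ⊢
    exact (Kernel.integral_comp hi).symm

/-- Under a reversing measure, the two-step law of the chain is symmetric. -/
lemma map_swap_compProd (h : K.IsReversible π) : (π ⊗ₘ K).map Prod.swap = π ⊗ₘ K := by
  refine Measure.ext_prod fun {s t} hs ht => ?_
  rw [Measure.map_apply measurable_swap (hs.prod ht), Set.preimage_swap_prod,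
    Measure.compProd_apply_prod ht hs, Measure.compProd_apply_prod hs ht, h ht hs]

lemma integrable_mul_compProd (h : K.Invariant π) {f g : X → ℂ} (hf : MemLp f 2 π)
    (hg : MemLp g 2 π) : Integrable (fun p : X × X => f p.1 * g p.2) (π ⊗ₘ K) := by
  have h1 : MeasurePreserving Prod.fst (π ⊗ₘ K) π :=
    ⟨measurable_fst, by rw [← Measure.fst, Measure.fst_compProd]⟩
  have h2 : MeasurePreserving Prod.snd (π ⊗ₘ K) π :=
    ⟨measurable_snd, by rw [← Measure.snd, Measure.snd_compProd, h.def]⟩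
  exact (hf.comp_measurePreserving h1).integrable_mul (hg.comp_measurePreserving h2)

/-- Written against the two-step law, the form makes self-adjointness a consequence of the symmetry
of that law under swapping coordinates. -/
lemma inner_l2Operator (h : K.Invariant π) (f g : Lp ℂ 2 π) :
    inner ℂ f (l2Operator K π h g) = ∫ p, star (f p.1) * g p.2 ∂(π ⊗ₘ K) := by
  rw [Measure.integral_compProd (f := fun p : X × X => star (f p.1) * g p.2)
    (integrable_mul_compProd h (Lp.memLp f).star (Lp.memLp g)), L2.inner_def]
  refine integral_congr_ae ?_
  filter_upwards [l2Operator_apply h g] with x hx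
  rw [hx, RCLike.inner_apply', integral_const_mul]
  rfl

lemma isSelfAdjoint_l2Operator (h : K.IsReversible π) :
    IsSelfAdjoint (l2Operator K π h.invariant) := by
  rw [ContinuousLinearMap.isSelfAdjoint_iff_isSymmetric]
  intro f g
  change inner ℂ (l2Operator K π h.invariant f) g = inner ℂ f (l2Operator K π h.invariant g)
  rw [← inner_conj_symm, inner_l2Operator, inner_l2Operator, ← integral_conj]
  conv_rhs => rw [← map_swap_compProd h]
  rw [show (Prod.swap : X × X → X × X) = MeasurableEquiv.prodComm from rfl,
    (MeasurableEquiv.prodComm (α := X) (β := X)).measurableEmbedding.integral_map]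
  refine integral_congr_ae (ae_of_all _ fun p => ?_)
  change star (star (g p.1) * f p.2) = star (f p.2) * g p.1
  simp [mul_comm]

/-- The constant function `1`. -/
noncomputable def l2One (π : Measure X) [IsProbabilityMeasure π] : Lp ℂ 2 π :=
  indicatorConstLp 2 MeasurableSet.univ (measure_ne_top π _) 1

lemma coeFn_l2One : l2One π =ᵐ[π] fun _ => (1 : ℂ) := by
  have := indicatorConstLp_coeFn (p := 2) (hs := MeasurableSet.univ)
    (hμs := measure_ne_top π Set.univ) (c := (1 : ℂ))
  rwa [Set.indicator_univ] at this

lemma norm_l2One : ‖l2One π‖ = 1 := by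
  rw [l2One, norm_indicatorConstLp (by norm_num) (by norm_num)]
  simp

lemma inner_l2One (f : Lp ℂ 2 π) : inner ℂ (l2One π) f = ∫ x, f x ∂π := by
  rw [l2One, L2.inner_indicatorConstLp_one, setIntegral_univ]

lemma l2Operator_l2One (h : K.Invariant π) : l2Operator K π h (l2One π) = l2One π := by
  ext1
  filter_upwards [l2Operator_apply h (l2One π), integral_ae_congr h (coeFn_l2One (π := π)),
    coeFn_l2One (π := π)] with x h1 h2 h3
  rw [h1, h2, h3]
  simp

/-- The fixed points of the transition operator of an irreducible chain are constant. -/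
lemma exists_eq_smul_l2One (h : K.Invariant π) {ψ : Measure X} (hψ : ψ ≠ 0)
    (hc : EventuallyCharges K ψ) {f : Lp ℂ 2 π} (hf : l2Operator K π h f = f) :
    ∃ c : ℂ, f = c • l2One π := by
  have hm := Lp.stronglyMeasurable f
  have hfix (n : ℕ) : (l2Operator K π h ^ n) f = f := by
    induction n with
    | zero => simp
    | succ n ih => rw [pow_succ, mul_apply_eq_comp, hf, ih]
  have hae : ∀ᵐ x ∂π, ∀ n : ℕ, ∀ᵐ y ∂((K ^ n) x), f y = f x := by
    rw [ae_all_iff]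
    intro n
    refine ae_ae_eq_of_integral_eq (invariant_pow h n) (Lp.memLp f) hm ?_
    have := l2Operator_pow_apply h f n
    rw [hfix] at this
    exact this.symm
  -- The set where `f` differs from `f x` is null for every `(K ^ n) x`; were it `ψ`-positive, some
  -- `n` would charge it.
  have hψx (x : X) (hx : ∀ n : ℕ, ∀ᵐ y ∂((K ^ n) x), f y = f x) : ∀ᵐ y ∂ψ, f y = f x := by
    have hA : MeasurableSet {y | f y ≠ f x} :=
      (hm.measurable (measurableSet_singleton (f x))).compl
    by_contra hne
    obtain ⟨n, hn⟩ := (hc _ hA (pos_iff_ne_zero.2 hne) x).exists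
    exact hn.ne' (hx n)
  have : (ae ψ).NeBot := ae_neBot.2 hψ
  obtain ⟨x₀, hx₀⟩ := hae.exists
  refine ⟨f x₀, ?_⟩
  ext1
  filter_upwards [hae, Lp.coeFn_smul (f x₀) (l2One π), coeFn_l2One (π := π)] with x hx h1 h2
  -- As `ψ ≠ 0`, two `ψ`-conull sets share a point `y`, where `f x = f y = f x₀`.
  obtain ⟨y, hy, hy₀⟩ := ((hψx x hx).and (hψx x₀ hx₀)).exists
  rw [h1, Pi.smul_apply, h2, ← hy, hy₀, smul_eq_mul, mul_one]

/-- The orthogonal projection onto the constants. -/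
noncomputable def constProj (π : Measure X) [IsProbabilityMeasure π] :
    Lp ℂ 2 π →L[ℂ] Lp ℂ 2 π :=
  InnerProductSpace.rankOne ℂ (l2One π) (l2One π)

lemma constProj_apply (f : Lp ℂ 2 π) : constProj π f = (∫ x, f x ∂π) • l2One π := by
  rw [constProj, InnerProductSpace.rankOne_apply, inner_l2One]

lemma l2Operator_mul_constProj (h : K.Invariant π) :
    l2Operator K π h * constProj π = constProj π := by
  ext1 f
  rw [mul_apply_eq_comp, constProj_apply, map_smul, l2Operator_l2One]

lemma isStarProjection_constProj : IsStarProjection (constProj π) :=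
  InnerProductSpace.isStarProjection_rankOne_self norm_l2One

lemma constProj_l2One : constProj π (l2One π) = l2One π := by
  rw [constProj, InnerProductSpace.rankOne_apply, inner_self_eq_norm_sq_to_K, norm_l2One]
  simp

lemma constProj_mul_l2Operator (h : K.IsReversible π) :
    constProj π * l2Operator K π h.invariant = constProj π := by
  have := congr(star $(l2Operator_mul_constProj h.invariant))
  rwa [star_mul, (isSelfAdjoint_l2Operator h).star_eq,
    isStarProjection_constProj.isSelfAdjoint.star_eq] at this

/-- Geometric convergence of the powers of the transition operator in operator norm. -/
lemma norm_l2Operator_pow_sub_le (h : K.IsReversible π) {ψ : Measure X} (hψ : ψ ≠ 0)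
    (hc : EventuallyCharges K ψ) (hgap : 0 < spectralGap (l2Operator K π h.invariant))
    {n : ℕ} (hn : 1 ≤ n) :
    ‖l2Operator K π h.invariant ^ n - constProj π‖ ≤
      (1 - spectralGap (l2Operator K π h.invariant)) ^ n := by
  have hTQ := l2Operator_mul_constProj h.invariant
  rw [← sub_pow_eq_pow_sub isStarProjection_constProj.isIdempotentElem hTQ
    (constProj_mul_l2Operator h) hn]
  refine (norm_pow_le' _ hn).trans (pow_le_pow_left₀ (norm_nonneg _) ?_ n)
  refine norm_sub_le_one_sub_spectralGap (isSelfAdjoint_l2Operator h) isStarProjection_constProj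
    hTQ (fun f hf => ?_) hgap
  obtain ⟨c, rfl⟩ := exists_eq_smul_l2One h.invariant hψ hc hf
  rw [map_smul, constProj_l2One]

/-- The indicator function of a set lies at distance `1 / 2` from the constant `1 / 2`. -/
lemma norm_indicatorConstLp_sub_half_le {A : Set X} (hA : MeasurableSet A) :
    ‖indicatorConstLp 2 hA (measure_ne_top π A) (1 : ℂ) - (1 / 2 : ℂ) • l2One π‖ ≤ 1 / 2 := by
  refine (Lp.norm_le_of_ae_bound (C := 1 / 2) (by norm_num) ?_).trans_eq ?_
  · filter_upwards [Lp.coeFn_sub (indicatorConstLp 2 hA (measure_ne_top π A) (1 : ℂ))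
      ((1 / 2 : ℂ) • l2One π), Lp.coeFn_smul (1 / 2 : ℂ) (l2One π), coeFn_l2One (π := π),
      indicatorConstLp_coeFn (p := 2) (hs := hA) (hμs := measure_ne_top π A) (c := (1 : ℂ))]
      with x h1 h2 h3 h4
    rw [h1, Pi.sub_apply, h2, Pi.smul_apply, h3, h4]
    by_cases hx : x ∈ A <;> norm_num [hx]
  · simp [measureUnivNNReal]

lemma norm_integral_mul_kernel_le (h : K.IsReversible π) {ψ : Measure X} (hψ : ψ ≠ 0)
    (hc : EventuallyCharges K ψ) (hgap : 0 < spectralGap (l2Operator K π h.invariant))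
    {n : ℕ} (hn : 1 ≤ n) {A : Set X} (hA : MeasurableSet A) {g : X → ℝ} (hg : MemLp g 2 π)
    (hg0 : ∫ x, g x ∂π = 0) :
    |∫ x, g x * ((K ^ n) x).real A ∂π| ≤
      1 / 2 * (eLpNorm g 2 π).toReal * (1 - spectralGap (l2Operator K π h.invariant)) ^ n := by
  set T := l2Operator K π h.invariant
  let G : Lp ℂ 2 π := (hg.ofReal (K := ℂ)).toLp (fun x => (g x : ℂ))
  have hG : G =ᵐ[π] fun x => (g x : ℂ) := MemLp.coeFn_toLp _
  let a : Lp ℂ 2 π := indicatorConstLp 2 hA (measure_ne_top π A) (1 : ℂ)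
  have hGnorm : ‖G‖ = (eLpNorm g 2 π).toReal := by
    rw [Lp.norm_toLp]
    congr 1
    exact eLpNorm_congr_norm_ae (ae_of_all _ fun x => by simp)
  have hG1 : inner ℂ G (l2One π) = 0 := by
    rw [← inner_conj_symm, inner_l2One, integral_congr_ae hG, integral_complex_ofReal, hg0]
    simp
  have hTa : (T ^ n) a =ᵐ[π] fun x => (((K ^ n) x).real A : ℂ) := by
    have h1 := integral_ae_congr (invariant_pow h.invariant n)
      (indicatorConstLp_coeFn (p := 2) (hs := hA) (hμs := measure_ne_top π A) (c := (1 : ℂ)))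
    filter_upwards [l2Operator_pow_apply h.invariant a n, h1] with x hx hx'
    rw [hx, hx', integral_indicator hA]
    simp
  have hinner : inner ℂ G ((T ^ n) a) = ((∫ x, g x * ((K ^ n) x).real A ∂π : ℝ) : ℂ) := by
    rw [L2.inner_def, ← integral_complex_ofReal]
    refine integral_congr_ae ?_
    filter_upwards [hG, hTa] with x h1 h2
    rw [h1, h2]
    simp [mul_comm]
  have hTone : (T ^ n) (l2One π) = l2One π := by
    clear hinner hTa hn
    induction n with
    | zero => simp
    | succ n ih => rw [pow_succ, mul_apply_eq_comp, l2Operator_l2One, ih]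
  -- Centring the indicator at `1/2` costs nothing here and halves the bound on its norm.
  have hS : inner ℂ G ((T ^ n - constProj π) (a - (1 / 2 : ℂ) • l2One π)) =
      inner ℂ G ((T ^ n) a) := by
    rw [map_sub, map_smul, sub_apply, sub_apply, hTone, constProj_l2One, sub_self, smul_zero,
      sub_zero, constProj_apply, inner_sub_right, inner_smul_right, hG1, mul_zero, sub_zero]
  have hle : ‖inner ℂ G ((T ^ n) a)‖ ≤ ‖G‖ * ((1 - spectralGap T) ^ n * (1 / 2)) := by
    rw [← hS]
    refine (norm_inner_le_norm _ _).trans ?_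
    gcongr
    refine ((T ^ n - constProj π).le_opNorm _).trans ?_
    exact mul_le_mul (norm_l2Operator_pow_sub_le h hψ hc hgap hn)
      (norm_indicatorConstLp_sub_half_le hA) (norm_nonneg _)
      (pow_nonneg (one_sub_spectralGap_nonneg T) n)
  rw [hinner, Complex.norm_real, Real.norm_eq_abs, hGnorm] at hle
  linarith

end Kernel

/-! ### The density of `μ - π` -/

section SignedMeasure

variable {X : Type*} [MeasurableSpace X] {μ π : Measure X} [IsProbabilityMeasure μ]
  [IsProbabilityMeasure π]

lemma absolutelyContinuous_of_toSignedMeasure_sub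
    (h : VectorMeasure.AbsolutelyContinuous (μ.toSignedMeasure - π.toSignedMeasure)
      π.toENNRealVectorMeasure) : μ ≪ π := by
  refine Measure.AbsolutelyContinuous.mk fun s hs h0 => ?_
  have h1 := h (s := s) (by rwa [Measure.toENNRealVectorMeasure_apply_measurable hs])
  rw [sub_apply, Measure.toSignedMeasure_apply_measurable hs,
    Measure.toSignedMeasure_apply_measurable hs, measureReal_def π, h0, ENNReal.toReal_zero,
    sub_zero] at h1
  exact (measureReal_eq_zero_iff).1 h1

/-- Uniqueness of the Lebesgue decomposition, with zero singular part. -/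
lemma rnDeriv_toSignedMeasure_sub (h : μ ≪ π) :
    (fun x => (μ.rnDeriv π x).toReal - 1) =ᵐ[π]
      (μ.toSignedMeasure - π.toSignedMeasure).rnDeriv π := by
  have hi : Integrable (fun x => (μ.rnDeriv π x).toReal) π := Measure.integrable_toReal_rnDeriv
  refine SignedMeasure.eq_rnDeriv 0 _ (hi.sub (integrable_const 1))
    VectorMeasure.MutuallySingular.zero_left ?_
  rw [zero_add]
  ext s hs
  rw [withDensityᵥ_apply (f := fun x => (μ.rnDeriv π x).toReal - 1) (hi.sub (integrable_const 1)) hs, sub_apply,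
    Measure.toSignedMeasure_apply_measurable hs, Measure.toSignedMeasure_apply_measurable hs,
    integral_sub hi.integrableOn (integrable_const 1).integrableOn,
    Measure.setIntegral_toReal_rnDeriv h]
  simp

lemma integral_rnDeriv_toSignedMeasure_sub_mul (h : μ ≪ π) {u : X → ℝ} (hμ : Integrable u μ)
    (hπ : Integrable u π) :
    ∫ x, (μ.toSignedMeasure - π.toSignedMeasure).rnDeriv π x * u x ∂π =
      ∫ x, u x ∂μ - ∫ x, u x ∂π := by
  rw [← integral_toReal_rnDeriv_mul h,
    ← integral_sub ((integrable_toReal_rnDeriv_mul_iff h).2 hμ) hπ]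
  refine integral_congr_ae ?_
  filter_upwards [rnDeriv_toSignedMeasure_sub h] with x hx
  rw [← hx]
  ring

end SignedMeasure

end MarkovL2

/-! ### The total variation bound -/

theorem proposition3 {X : Type*} [MeasurableSpace X] [MeasurableSpace.CountablyGenerated X]
    (P : ProbabilityTheory.Kernel X X) [ProbabilityTheory.IsMarkovKernel P]
    (π : MeasureTheory.Measure X) [MeasureTheory.IsProbabilityMeasure π]
    (hrev : P.IsReversible π)
    (ψ : MeasureTheory.Measure X) (hψ : MarkovL2.IsPsiIrreducibleAperiodic P ψ)
    (hgap : MarkovL2.HasSpectralGap (MarkovL2.l2Operator P π hrev.invariant))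
    (hδ : 0 < MarkovL2.spectralGap (MarkovL2.l2Operator P π hrev.invariant))
    (μ : MeasureTheory.Measure X) [MeasureTheory.IsProbabilityMeasure μ]
    -- excludes only the indeterminate right-hand side `∞ * 0`
    (hμ : MarkovL2.l2Norm π (μ.toSignedMeasure - π.toSignedMeasure) ≠ ∞ ∨
      MarkovL2.spectralGap (MarkovL2.l2Operator P π hrev.invariant) < 1)
    (n : ℕ) (hn : 1 ≤ n) :
    MarkovL2.tvNorm ((μ.bind (P ^ n)).toSignedMeasure - π.toSignedMeasure) ≤
      1 / 2 * MarkovL2.l2Norm π (μ.toSignedMeasure - π.toSignedMeasure) *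
        ENNReal.ofReal
          (1 - MarkovL2.spectralGap (MarkovL2.l2Operator P π hrev.invariant)) ^ n := by
  set ρ := 1 - MarkovL2.spectralGap (MarkovL2.l2Operator P π hrev.invariant)
  set ν := μ.toSignedMeasure - π.toSignedMeasure
  by_cases hinf : MarkovL2.l2Norm π ν = ∞
  -- In `ℝ≥0∞`, `∞ * 0 = 0`, so `ρ > 0` is needed for the right-hand side to be `∞`.
  · have hρ : 0 < ρ := sub_pos.2 (hμ.resolve_left (not_not_intro hinf))
    rw [hinf, ENNReal.mul_top (by norm_num), ENNReal.top_mul]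
    · exact le_top
    · exact pow_ne_zero n (ENNReal.ofReal_pos.2 hρ).ne'
  have hac : VectorMeasure.AbsolutelyContinuous ν π.toENNRealVectorMeasure := by
    by_contra hac
    exact hinf (if_neg hac)
  have hnorm : MarkovL2.l2Norm π ν = eLpNorm (ν.rnDeriv π) 2 π := if_pos hac
  rw [hnorm] at hinf ⊢
  have hμπ := MarkovL2.absolutelyContinuous_of_toSignedMeasure_sub hac
  have hg : MemLp (ν.rnDeriv π) 2 π :=
    ⟨(SignedMeasure.integrable_rnDeriv ν π).1, Ne.lt_top hinf⟩
  have hg0 : ∫ x, ν.rnDeriv π x ∂π = 0 := by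
    simpa using MarkovL2.integral_rnDeriv_toSignedMeasure_sub_mul hμπ
      (integrable_const (1 : ℝ)) (integrable_const (1 : ℝ))
  refine iSup_le fun ⟨A, hA⟩ => ?_
  have hu (m : Measure X) [IsProbabilityMeasure m] :
      Integrable (fun x => ((P ^ n) x).real A) m :=
    Integrable.of_bound ((P ^ n).measurable_coe hA).ennreal_toReal.aestronglyMeasurable 1
      (ae_of_all _ fun x => by
        rw [Real.norm_of_nonneg measureReal_nonneg]; exact measureReal_le_one)
  have hval : ((μ.bind (P ^ n)).toSignedMeasure - π.toSignedMeasure) A =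
      ∫ x, ν.rnDeriv π x * ((P ^ n) x).real A ∂π := by
    rw [MarkovL2.integral_rnDeriv_toSignedMeasure_sub_mul hμπ (hu μ) (hu π),
      ← MarkovL2.measureReal_bind hA, ← MarkovL2.measureReal_bind hA,
      (MarkovL2.invariant_pow hrev.invariant n).def, sub_apply,
      Measure.toSignedMeasure_apply_measurable hA, Measure.toSignedMeasure_apply_measurable hA]
  have hle := MarkovL2.norm_integral_mul_kernel_le hrev hψ.ne_zero hψ.charges hδ hn hA hg hg0
  rw [hval, Real.enorm_eq_ofReal_abs]
  refine (ENNReal.ofReal_le_ofReal hle).trans_eq ?_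
  rw [ENNReal.ofReal_mul (by positivity), ENNReal.ofReal_mul (by norm_num),
    ENNReal.ofReal_toReal hinf,
    ENNReal.ofReal_pow (MarkovL2.one_sub_spectralGap_nonneg _), one_div, one_div,
    ENNReal.ofReal_inv_of_pos two_pos, ENNReal.ofReal_ofNat]
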